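/- A digraph $D$ consists of a vertex set $V$ and an edge set $E$ (finite or infinite), each edge having a tail and a head in $V$; parallel edges and loops are allowed. A dicut of $D$ is a set $B\subseteq E$ for which there is a partition of $V$ into two non-empty sets $X,Y$ such that $B$ is the set of all edges with one end in $X$ and the other in $Y$, and all edges in $B$ have their head in $Y$. For a class $\mathfrak B$ of dicuts, a $\mathfrak B$-dijoin is a set of edges meeting every $B\in\mathfrak B$. A capacity is a map $c$ from $E$ to the cardinals, and $c(A)$ is the cardinal sum $\sum_{e\in A}c(e)$ for $A\subseteq E$. A family $(F_i)_{i\in I}$ of sets of edges (repetitions allowed) is $c$-disjoint if every edge $e$ lies in $F_i$ for at most $c(e)$ many indices $i\in I$. Theorem. Let $D$ be a digraph, possibly infinite, and let $\mathfrak A$ be either the class of all dicuts of $D$ or the class of all non-empty dicuts of $D$. (i) Suppose that $\mathfrak A$ contains a finite dicut, and let $\mathfrak B_{\min}$ be the class of members of $\mathfrak A$ of minimum size. Then the maximum size of a set of pairwise disjoint $\mathfrak B_{\min}$-dijoins exists and is equal to the minimum size of a dicut in $\mathfrak A$. (ii) Let $c$ be a capacity of $D$, suppose that $\mathfrak A$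 contains a dicut of finite capacity, and let $\mathfrak B_{\min}$ be the class of members of $\mathfrak A$ of minimum capacity. Then the maximum size of a $c$-disjoint family of $\mathfrak B_{\min}$-dijoins exists and is equal to the minimum capacity of a dicut in $\mathfrak A$. (iii) In particular, the conclusion of (ii) holds whenever $V$ and $E$ are finite, $\mathfrak A\neq\emptyset$, and $c$ takes values in the non-negative integers. -/

import Mathlib

open scoped Cardinal

universe u v

/-- A digraph with vertex set `V` and edge set `E`, given by the tail and the head of each edge.
Parallel edges and loops are allowed, and both sets may be infinite. -/
structure Multidigraph (V : Type v) (E : Type u) where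
  tail : E → V
  head : E → V

namespace Multidigraph

variable {V : Type v} {E : Type u}

/-- The set of edges that have one end in `X \ Y` and the other end in `Y \ X`. -/
def edgesBetween (D : Multidigraph V E) (X Y : Set V) : Set E :=
  {e | (D.head e ∈ X \ Y ∧ D.tail e ∈ Y \ X) ∨ (D.head e ∈ Y \ X ∧ D.tail e ∈ X \ Y)}

/-- `(X, Y)` is a bipartition of the vertex set with two non-empty sides. -/
def IsNontrivialBipartition (X Y : Set V) : Prop :=
  X ∩ Y = ∅ ∧ X ∪ Y = Set.univ ∧ X.Nonempty ∧ Y.Nonempty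

/-- `B` is a dicut: a cut of `D` all of whose edges have their head in one common side.
That side may be called `Y`, since `edgesBetween` is symmetric in the two sides. -/
def IsDicut (D : Multidigraph V E) (B : Set E) : Prop :=
  ∃ X Y : Set V, IsNontrivialBipartition X Y ∧ B = D.edgesBetween X Y ∧ ∀ e ∈ B, D.head e ∈ Y

/-- The class of all dicuts of `D`. The empty set is one of them exactly when `D` has a
non-trivial bipartition without edges between its sides. -/
def dicuts (D : Multidigraph V E) : Set (Set E) := {B | D.IsDicut B}

/-- The class of all non-empty dicuts of `D`. -/
def nonemptyDicuts (D : Multidigraph V E) : Set (Set E) := {B | D.IsDicut B ∧ B.Nonempty}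

end Multidigraph

section Packing

variable {E : Type u}

/-- A `𝔅`-dijoin: a set of edges meeting every member of the class `𝔅`. -/
def IsDijoin (𝔅 : Set (Set E)) (F : Set E) : Prop := ∀ B ∈ 𝔅, (F ∩ B).Nonempty

/-- The members of `𝔄` of minimum size. -/
def minSize (𝔄 : Set (Set E)) : Set (Set E) := {B ∈ 𝔄 | ∀ B' ∈ 𝔄, #B ≤ #B'}

/-- The minimum size of a member of `𝔅` and the maximum size of a set of pairwise disjoint
`𝔅`-dijoins exist and are equal. -/
def IsWoodall (𝔅 : Set (Set E)) : Prop :=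
  ∃ m : Cardinal.{u}, IsLeast {κ | ∃ B ∈ 𝔅, #B = κ} m ∧
    IsGreatest {κ | ∃ 𝓕 : Set (Set E), (∀ F ∈ 𝓕, IsDijoin 𝔅 F) ∧
      (∀ F ∈ 𝓕, ∀ F' ∈ 𝓕, F ≠ F' → Disjoint F F') ∧ #𝓕 = κ} m

/-- The capacity `c(A)` of a set `A` of edges: the cardinal sum of the capacities of its edges. -/
noncomputable def capacityOf (c : E → Cardinal.{u}) (A : Set E) : Cardinal.{u} :=
  Cardinal.sum fun e : A => c e

/-- The members of `𝔄` of minimum capacity. -/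
def minCapacity (c : E → Cardinal.{u}) (𝔄 : Set (Set E)) : Set (Set E) :=
  {B ∈ 𝔄 | ∀ B' ∈ 𝔄, capacityOf c B ≤ capacityOf c B'}

/-- The minimum capacity of a member of `𝔅` and the maximum size of a `c`-disjoint family of
`𝔅`-dijoins exist and are equal. A family is `c`-disjoint if every edge `e` lies in at most
`c e` of its members, counted with multiplicity. -/
def IsWoodallWrt (c : E → Cardinal.{u}) (𝔅 : Set (Set E)) : Prop :=
  ∃ m : Cardinal.{u}, IsLeast {κ | ∃ B ∈ 𝔅, capacityOf c B = κ} m ∧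
    IsGreatest {κ | ∃ (ι : Type u) (F : ι → Set E), (∀ i, IsDijoin 𝔅 (F i)) ∧
      (∀ e, #{i | e ∈ F i} ≤ c e) ∧ #ι = κ} m

end Packing

/-! ### König's edge colouring theorem and colourings of two disjoint families. -/

section EdgeColoring

open Finset

/-! Let k > 0 be the minimum capacity. Replace each edge of finite capacity by that many copies; it
suffices to colour the copies with k colours so that every minimum dicut shows all colours, for the
colour classes then give k dijoins. Conversely, members of a packing use up capacity in any one
minimum dicut, so there are at most k.

By compactness (`exists_surjOn_of_finite`) finitely many minimum dicuts suffice. Their shores cut V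
into finitely many cells, and the tail-closed unions of cells form a finite lattice.
`exists_isRainbow` colours by induction on its size. If some k-cut has a shore X that can be
contracted on either side with loss of lattice members, colour both smaller lattices, permute
colours to agree on the cut of X, and glue. A remaining k-cut with shore Y is uncrossed with X:
counting the edges of one colour is modular on tail-closed sets, so Y inherits one edge of each
colour from X, X ∩ Y and X ∪ Y. If there is no such X, the k-cuts form two families, each of
pairwise disjoint cuts, and König's theorem colours both at once
(`exists_injOn_of_pairwiseDisjoint`). -/

theorem card_filter_mem_of_card_fiber_eq {E A : Type*} [DecidableEq A] {k : ℕ} (f : E → A)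
    (S : Finset E) (hf : ∀ a, card {e ∈ S | f e = a} = k) (s : Finset A) :
    card {e ∈ S | f e ∈ s} = card s * k := by
  have hmaps : ∀ e ∈ ({e ∈ S | f e ∈ s} : Finset E), f e ∈ s := fun e he => (mem_filter.1 he).2
  rw [card_eq_sum_card_fiberwise hmaps, sum_const_nat]
  intro a ha
  rw [← hf a, filter_filter]
  congr 1
  ext e
  simp only [mem_filter]
  constructor
  · rintro ⟨h, -, h'⟩; exact ⟨h, h'⟩
  · rintro ⟨h, rfl⟩; exact ⟨h, ha, rfl⟩

/-- A finite bipartite multigraph in which every vertex of both sides has degree `k` has a proper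
edge colouring with `k` colours. -/
theorem exists_edgeColoring_of_regular {E A : Type*} [DecidableEq E] [DecidableEq A] [Finite A]
    (f g : E → A) (k : ℕ) (S : Finset E) (hf : ∀ a, card {e ∈ S | f e = a} = k)
    (hg : ∀ a, card {e ∈ S | g e = a} = k) :
    ∃ col : E → ℕ, (∀ e ∈ S, col e < k) ∧
      ∀ e ∈ S, ∀ e' ∈ S, (f e = f e' ∨ g e = g e') → col e = col e' → e = e' := by
  induction k generalizing S with
  | zero =>
    have hS : ∀ e, e ∉ S := fun e he => by
      have h := card_eq_zero.1 (hf (f e))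
      exact notMem_empty e (h ▸ mem_filter.2 ⟨he, rfl⟩)
    exact ⟨fun _ => 0, fun e he => (hS e he).elim, fun e he => (hS e he).elim⟩
  | succ k ih =>
    -- Hall's condition by double counting: all edges at `s` end in the neighbourhood `T`, and all
    -- degrees equal `k + 1`.
    have hall : ∀ s : Finset A, card s ≤ card (s.biUnion fun a => image g {e ∈ S | f e = a}) := by
      intro s
      set T := s.biUnion fun a => image g {e ∈ S | f e = a}
      have h1 := card_filter_mem_of_card_fiber_eq f S hf s
      have h2 := card_filter_mem_of_card_fiber_eq g S hg T
      have h3 : card {e ∈ S | f e ∈ s} ≤ card {e ∈ S | g e ∈ T} := by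
        apply card_le_card
        intro e he
        rw [mem_filter] at he ⊢
        exact ⟨he.1, mem_biUnion.2 ⟨f e, he.2, mem_image.2 ⟨e, mem_filter.2 ⟨he.1, rfl⟩, rfl⟩⟩⟩
      rw [h1, h2] at h3
      exact Nat.le_of_mul_le_mul_right h3 k.succ_pos
    obtain ⟨σ, hσ, hσt⟩ := (all_card_le_biUnion_card_iff_exists_injective _).1 hall
    -- Both sides are the same finite type, so the matching covers both, and deleting it lowers
    -- every degree by one.
    have hσ' : Function.Surjective σ := Finite.surjective_of_injective hσ
    have hex : ∀ a, ∃ e ∈ S, f e = a ∧ g e = σ a := fun a => by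
      obtain ⟨e, he, h⟩ := mem_image.1 (hσt a)
      exact ⟨e, (mem_filter.1 he).1, (mem_filter.1 he).2, h⟩
    choose m hmS hmf hmg using hex
    have hSf : ∀ a, card {e ∈ {e ∈ S | m (f e) ≠ e} | f e = a} = k := by
      intro a
      have : ({e ∈ {e ∈ S | m (f e) ≠ e} | f e = a} : Finset E)
          = ({e ∈ S | f e = a} : Finset E).erase (m a) := by
        ext e
        simp only [mem_filter, mem_erase]
        constructor
        · rintro ⟨⟨h1, h2⟩, rfl⟩; exact ⟨h2.symm, h1, rfl⟩
        · rintro ⟨h2, h1, rfl⟩; exact ⟨⟨h1, h2.symm⟩, rfl⟩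
      rw [this, card_erase_of_mem (mem_filter.2 ⟨hmS a, hmf a⟩), hf]
      rfl
    have hSg : ∀ a, card {e ∈ {e ∈ S | m (f e) ≠ e} | g e = a} = k := by
      intro b
      obtain ⟨a, rfl⟩ := hσ' b
      have : ({e ∈ {e ∈ S | m (f e) ≠ e} | g e = σ a} : Finset E)
          = ({e ∈ S | g e = σ a} : Finset E).erase (m a) := by
        ext e
        simp only [mem_filter, mem_erase]
        constructor
        · rintro ⟨⟨h1, h2⟩, h3⟩
          refine ⟨?_, h1, h3⟩
          rintro rfl
          exact h2 (by rw [hmf])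
        · rintro ⟨h2, h1, h3⟩
          refine ⟨⟨h1, fun h4 => h2 ?_⟩, h3⟩
          have : f e = a := hσ (by rw [← hmg, h4, h3])
          rw [← this, h4]
      rw [this, card_erase_of_mem (mem_filter.2 ⟨hmS a, hmg a⟩), hg]
      rfl
    obtain ⟨col, hlt, hcol⟩ := ih _ hSf hSg
    refine ⟨fun e => if m (f e) = e then k else col e, ?_, ?_⟩
    · intro e he
      dsimp only
      split_ifs with h
      · exact k.lt_succ_self
      · exact (hlt e (mem_filter.2 ⟨he, h⟩)).trans k.lt_succ_self
    · intro e he e' he' hadj hc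
      dsimp only at hc
      split_ifs at hc with h h' h'
      · rcases hadj with h1 | h1
        · rw [← h, ← h', h1]
        · rw [← h, ← h', hmg, hmg] at h1
          rw [← h, ← h', hσ h1]
      · exact absurd hc (hlt e' (mem_filter.2 ⟨he', h'⟩)).ne'
      · exact absurd hc (hlt e (mem_filter.2 ⟨he, h⟩)).ne
      · exact hcol e (mem_filter.2 ⟨he, h⟩) e' (mem_filter.2 ⟨he', h'⟩) hadj hc

/-- **König's edge colouring theorem**: a finite bipartite multigraph of maximum degree at most `k`
has a proper edge colouring with `k` colours. -/
theorem exists_edgeColoring {E A B : Type*} [Fintype E] [DecidableEq E] [Fintype A]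
    [DecidableEq A] [Fintype B] [DecidableEq B] (f : E → A) (g : E → B) (k : ℕ)
    (hf : ∀ a, card {e | f e = a} ≤ k) (hg : ∀ b, card {e | g e = b} ≤ k) :
    ∃ col : E → ℕ, (∀ e, col e < k) ∧
      ∀ e e', (f e = f e' ∨ g e = g e') → col e = col e' → e = e' := by
  -- Regularisation: add a second copy of the graph with its sides swapped, and join the two copies
  -- of each vertex `x` by `d x` edges, its deficiency.
  let d : A ⊕ B → ℕ := Sum.elim (fun a => k - card {e | f e = a}) (fun b => k - card {e | g e = b})
  let f' : (E ⊕ E) ⊕ (Σ x, Fin (d x)) → A ⊕ B :=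
    Sum.elim (Sum.elim (fun e => .inl (f e)) (fun e => .inr (g e))) Sigma.fst
  let g' : (E ⊕ E) ⊕ (Σ x, Fin (d x)) → A ⊕ B :=
    Sum.elim (Sum.elim (fun e => .inr (g e)) (fun e => .inl (f e))) Sigma.fst
  obtain ⟨col, hlt, hcol⟩ := exists_edgeColoring_of_regular f' g' k univ
    (by
      rintro (a | b)
      · have := hf a
        have hd : d (.inl a) = k - card {e | f e = a} := rfl
        rw [card_filter] at this hd ⊢
        simp [-sum_boole, Fintype.sum_sum_type, Fintype.sum_sigma, f']
        omega
      · have := hg b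
        have hd : d (.inr b) = k - card {e | g e = b} := rfl
        rw [card_filter] at this hd ⊢
        simp [-sum_boole, Fintype.sum_sum_type, Fintype.sum_sigma, f']
        omega)
    (by
      rintro (a | b)
      · have := hf a
        have hd : d (.inl a) = k - card {e | f e = a} := rfl
        rw [card_filter] at this hd ⊢
        simp [-sum_boole, Fintype.sum_sum_type, Fintype.sum_sigma, g']
        omega
      · have := hg b
        have hd : d (.inr b) = k - card {e | g e = b} := rfl
        rw [card_filter] at this hd ⊢
        simp [-sum_boole, Fintype.sum_sum_type, Fintype.sum_sigma, g']
        omega)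
  refine ⟨fun e => col (.inl (.inl e)), fun e => hlt _ (mem_univ _), fun e e' h hc => ?_⟩
  have := hcol _ (mem_univ (.inl (.inl e))) _ (mem_univ (.inl (.inl e')))
    (by simpa [f', g'] using h) hc
  simpa using this

/-- The equivalence classes, as sets, of the relation of lying in a common member of `𝒮`. -/
theorem exists_fiber_of_pairwiseDisjoint {E : Type*} [Finite E] (𝒮 : Set (Set E)) {k : ℕ}
    (hk : 0 < k) (h𝒮 : 𝒮.PairwiseDisjoint id) (hcard : ∀ S ∈ 𝒮, S.ncard ≤ k) :
    ∃ f : E → Set E, (∀ a, {e | f e = a}.ncard ≤ k) ∧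
      ∀ S ∈ 𝒮, ∀ e ∈ S, ∀ e' ∈ S, f e = f e' := by
  have huniq : ∀ S ∈ 𝒮, ∀ T ∈ 𝒮, ∀ e, e ∈ S → e ∈ T → S = T := fun S hS T hT e heS heT =>
    h𝒮.elim_set hS hT e heS heT
  refine ⟨fun e => {e' | e = e' ∨ ∃ S ∈ 𝒮, e ∈ S ∧ e' ∈ S}, fun a => ?_, fun S hS e he e' he' => ?_⟩
  · rcases Set.eq_empty_or_nonempty {e : E | {e' | e = e' ∨ ∃ S ∈ 𝒮, e ∈ S ∧ e' ∈ S} = a} with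
      h0 | ⟨e, he⟩
    · rw [h0]; simp
    · have hsub : {e : E | {e' | e = e' ∨ ∃ S ∈ 𝒮, e ∈ S ∧ e' ∈ S} = a} ⊆
          {e' | e = e' ∨ ∃ S ∈ 𝒮, e ∈ S ∧ e' ∈ S} := by
        intro e' he'
        have h1 : e' ∈ {x | e' = x ∨ ∃ S ∈ 𝒮, e' ∈ S ∧ x ∈ S} := Or.inl rfl
        rw [show {x | e' = x ∨ ∃ S ∈ 𝒮, e' ∈ S ∧ x ∈ S} = a from he'] at h1
        rwa [← show {x | e = x ∨ ∃ S ∈ 𝒮, e ∈ S ∧ x ∈ S} = a from he] at h1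
      by_cases h : ∃ S ∈ 𝒮, e ∈ S
      · obtain ⟨S, hS, heS⟩ := h
        refine (Set.ncard_le_ncard (hsub.trans ?_)).trans (hcard S hS)
        rintro e' (rfl | ⟨T, hT, heT, heT'⟩)
        · exact heS
        · rwa [huniq S hS T hT e heS heT]
      · refine (Set.ncard_le_ncard (t := {e}) (hsub.trans ?_)).trans ?_
        · rintro e' (rfl | ⟨T, hT, heT, -⟩)
          · rfl
          · exact (h ⟨T, hT, heT⟩).elim
        · rw [Set.ncard_singleton]; exact hk
  · have key : ∀ x ∈ S, {y | x = y ∨ ∃ T ∈ 𝒮, x ∈ T ∧ y ∈ T} = S := by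
      intro x hx
      ext y
      constructor
      · rintro (rfl | ⟨T, hT, hxT, hyT⟩)
        · exact hx
        · rwa [huniq S hS T hT x hx hxT]
      · exact fun hy => Or.inr ⟨S, hS, hx, hy⟩
    exact (key e he).trans (key e' he').symm

/-- Two families of pairwise disjoint sets, all of size at most `k`, in a finite set have a common
colouring with `k` colours that is injective on every member. -/
theorem exists_injOn_of_pairwiseDisjoint {E : Type*} [Finite E] (𝒮 𝒯 : Set (Set E)) {k : ℕ}
    (hk : 0 < k) (h𝒮 : 𝒮.PairwiseDisjoint id) (h𝒯 : 𝒯.PairwiseDisjoint id)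
    (hcard : ∀ S ∈ 𝒮 ∪ 𝒯, S.ncard ≤ k) :
    ∃ col : E → ℕ, (∀ e, col e < k) ∧ ∀ S ∈ 𝒮 ∪ 𝒯, Set.InjOn col S := by
  classical
  have := Fintype.ofFinite E
  obtain ⟨f, hf, hf'⟩ := exists_fiber_of_pairwiseDisjoint 𝒮 hk h𝒮 fun S hS => hcard S (.inl hS)
  obtain ⟨g, hg, hg'⟩ := exists_fiber_of_pairwiseDisjoint 𝒯 hk h𝒯 fun S hS => hcard S (.inr hS)
  -- The classes of `𝒮` and `𝒯` serve as the two vertex sides, and each element of `E` is an edge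
  -- joining its two classes.
  obtain ⟨col, hlt, hcol⟩ := exists_edgeColoring f g k
    (fun a => by simpa [Set.ncard_eq_toFinset_card'] using hf a)
    (fun a => by simpa [Set.ncard_eq_toFinset_card'] using hg a)
  refine ⟨col, hlt, ?_⟩
  rintro S (hS | hS) e he e' he' h
  · exact hcol e e' (.inl (hf' S hS e he e' he')) h
  · exact hcol e e' (.inr (hg' S hS e he e' he')) h

end EdgeColoring

/-! ### Tail-closed sets and rainbow cuts. -/

namespace Multidigraph

variable {V : Type v} {E : Type u}

/-- No edge enters `X`. -/
def IsTailClosed (D : Multidigraph V E) (X : Set V) : Prop :=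
  ∀ e, D.head e ∈ X → D.tail e ∈ X

/-- The set of edges that leave `X`. -/
def outCut (D : Multidigraph V E) (X : Set V) : Set E :=
  {e | D.tail e ∈ X ∧ D.head e ∉ X}

theorem IsTailClosed.inter {D : Multidigraph V E} {X Y : Set V} (hX : D.IsTailClosed X)
    (hY : D.IsTailClosed Y) : D.IsTailClosed (X ∩ Y) :=
  fun e h => ⟨hX e h.1, hY e h.2⟩

theorem IsTailClosed.union {D : Multidigraph V E} {X Y : Set V} (hX : D.IsTailClosed X)
    (hY : D.IsTailClosed Y) : D.IsTailClosed (X ∪ Y) :=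
  fun e h => h.imp (hX e) (hY e)

theorem IsTailClosed.compl {D : Multidigraph V E} {X : Set V} (h : D.outCut X = ∅) :
    D.IsTailClosed Xᶜ := fun e he ht =>
  Set.notMem_empty e (h ▸ (show e ∈ D.outCut X from ⟨ht, he⟩))

/-- Passing from dicuts to shores is what makes uncrossing possible: tail-closed sets are stable
under intersection and union. -/
theorem isDicut_iff {D : Multidigraph V E} {B : Set E} :
    D.IsDicut B ↔ ∃ X, X.Nonempty ∧ Xᶜ.Nonempty ∧ D.IsTailClosed X ∧ B = D.outCut X := by
  constructor
  · rintro ⟨X, Y, ⟨hi, hu, hX, hY⟩, rfl, hB⟩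
    obtain rfl : Y = Xᶜ := by
      ext v
      have h1 : v ∈ X ∪ Y := hu ▸ Set.mem_univ v
      have h2 : v ∉ X ∩ Y := hi ▸ Set.notMem_empty v
      simp only [Set.mem_union, Set.mem_inter_iff, Set.mem_compl_iff] at *
      tauto
    have hc : D.IsTailClosed X := fun e he => by
      by_contra ht
      exact hB e (Or.inl ⟨⟨he, not_not.2 he⟩, ht, ht⟩) he
    refine ⟨X, hX, hY, hc, ?_⟩
    ext e
    have := hc e
    simp only [edgesBetween, outCut, Set.mem_ofPred_eq, Set.mem_sdiff, Set.mem_compl_iff]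
    tauto
  · rintro ⟨X, hX, hY, hc, rfl⟩
    refine ⟨X, Xᶜ, ⟨Set.inter_compl_self X, Set.union_compl_self X, hX, hY⟩, ?_, fun e he => he.2⟩
    ext e
    have := hc e
    simp only [edgesBetween, outCut, Set.mem_ofPred_eq, Set.mem_sdiff, Set.mem_compl_iff]
    tauto

/-- The function counting the edges of `F` that leave a set is modular on tail-closed sets. -/
theorem ncard_outCut_inter_add_union [Finite E] {D : Multidigraph V E} {X Y : Set V}
    (hX : D.IsTailClosed X) (hY : D.IsTailClosed Y) (F : Set E) :
    (D.outCut (X ∩ Y) ∩ F).ncard + (D.outCut (X ∪ Y) ∩ F).ncard =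
      (D.outCut X ∩ F).ncard + (D.outCut Y ∩ F).ncard := by
  -- The two cuts on the left have the same union and the same intersection as the two on the right;
  -- an edge leaving only one of X and Y leaves X ∩ Y or X ∪ Y according to where its head lies.
  rw [← Set.ncard_union_add_ncard_inter (D.outCut (X ∩ Y) ∩ F),
    ← Set.ncard_union_add_ncard_inter (D.outCut X ∩ F)]
  congr 2
  all_goals
    ext e
    have h1 := hX e
    have h2 := hY e
    simp only [outCut, Set.mem_inter_iff, Set.mem_union, Set.mem_ofPred_eq]
    by_cases D.head e ∈ X <;> by_cases D.head e ∈ Y <;> (simp_all; try tauto)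

/-- Among the edges leaving `X`, exactly one has colour `i`, for every `i < k`. -/
def IsRainbow (D : Multidigraph V E) (col : E → ℕ) (k : ℕ) (X : Set V) : Prop :=
  ∀ i < k, (D.outCut X ∩ col ⁻¹' {i}).ncard = 1

theorem isRainbow_congr {D : Multidigraph V E} {col col' : E → ℕ} {k : ℕ} {X Y : Set V}
    (hXY : D.outCut X = D.outCut Y) (h : ∀ e ∈ D.outCut Y, col e = col' e) :
    D.IsRainbow col k X ↔ D.IsRainbow col' k Y := by
  refine forall₂_congr fun i _ => ?_
  have : D.outCut X ∩ col ⁻¹' {i} = D.outCut Y ∩ col' ⁻¹' {i} := by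
    ext e
    rw [hXY]
    exact and_congr_right fun he => by simp [h e he]
  rw [this]

/-- By modularity applied to each colour class, 1 + 1 = 1 + the number of edges of that colour
leaving Y. -/
theorem IsRainbow.of_inter_union [Finite E] {D : Multidigraph V E} {col : E → ℕ} {k : ℕ}
    {X Y : Set V} (hcX : D.IsTailClosed X) (hcY : D.IsTailClosed Y) (hX : D.IsRainbow col k X)
    (hi : D.IsRainbow col k (X ∩ Y)) (hu : D.IsRainbow col k (X ∪ Y)) :
    D.IsRainbow col k Y := by
  intro i hik
  have := ncard_outCut_inter_add_union hcX hcY (col ⁻¹' {i})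
  have := hX i hik
  have := hi i hik
  have := hu i hik
  omega

/-- A cut of `k` edges is rainbow if the colouring is injective on it and uses colours
below `k`. -/
theorem isRainbow_of_injOn [Finite E] {D : Multidigraph V E} {col : E → ℕ} {k : ℕ} {X : Set V}
    (hX : (D.outCut X).ncard = k) (hlt : ∀ e ∈ D.outCut X, col e < k)
    (hinj : Set.InjOn col (D.outCut X)) : D.IsRainbow col k X := by
  intro i hik
  have himg : col '' D.outCut X = Set.Iio k := by
    apply Set.eq_of_subset_of_ncard_le
    · rintro _ ⟨e, he, rfl⟩
      exact hlt e he
    · rw [hinj.ncard_image, hX, Set.ncard_eq_toFinset_card']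
      simp
    · exact Set.finite_Iio k
  obtain ⟨e, he, rfl⟩ : i ∈ col '' D.outCut X := himg ▸ hik
  rw [Set.ncard_eq_one]
  refine ⟨e, Set.eq_singleton_iff_unique_mem.2 ⟨⟨he, rfl⟩, fun e' he' => ?_⟩⟩
  exact hinj he'.1 he he'.2

/-- On a rainbow cut of `k` edges the colouring is injective and uses colours below `k`. -/
theorem IsRainbow.bijOn [Finite E] {D : Multidigraph V E} {col : E → ℕ} {k : ℕ} {X : Set V}
    (hX : (D.outCut X).ncard = k) (h : D.IsRainbow col k X) :
    Set.BijOn col (D.outCut X) (Set.Iio k) := by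
  have hsub : Set.Iio k ⊆ col '' D.outCut X := by
    intro i hi
    obtain ⟨e, he⟩ := Set.ncard_eq_one.1 (h i hi)
    have : e ∈ D.outCut X ∩ col ⁻¹' {i} := he ▸ rfl
    exact ⟨e, this.1, this.2⟩
  have hk : (Set.Iio k).ncard = k := by
    rw [Set.ncard_eq_toFinset_card']
    simp
  have hle : (col '' D.outCut X).ncard ≤ (D.outCut X).ncard := Set.ncard_image_le
  have heq := Set.eq_of_subset_of_ncard_le hsub (by omega)
  rw [heq]
  exact (Set.injOn_of_ncard_image_eq (by rw [← heq]; omega)).bijOn_image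

end Multidigraph

/-! ### The uncrossing induction on a finite lattice. -/

namespace Multidigraph

variable {V : Type v} {E : Type u}

/-- The case in which every cut of size `k` has an extreme shore. -/
theorem exists_isRainbow_of_extreme [Finite E] (D : Multidigraph V E) {k : ℕ} (hk : 0 < k)
    (L : Set (Set V))
    (hext : ∀ X ∈ L, (D.outCut X).ncard = k →
      (∀ Z ∈ L, Z ⊆ X ∨ Xᶜ ⊆ Z) ∨ (∀ Z ∈ L, X ⊆ Z ∨ Disjoint X Z)) :
    ∃ col : E → ℕ, ∀ Z ∈ L, (D.outCut Z).ncard = k → D.IsRainbow col k Z := by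
  let 𝒮 : Set (Set E) := {B | ∃ X ∈ L, B = D.outCut X ∧ B.ncard = k ∧ ∀ Z ∈ L, X ⊆ Z ∨ Disjoint X Z}
  let 𝒯 : Set (Set E) := {B | ∃ X ∈ L, B = D.outCut X ∧ B.ncard = k ∧ ∀ Z ∈ L, Z ⊆ X ∨ Xᶜ ⊆ Z}
  have h𝒮 : 𝒮.PairwiseDisjoint id := by
    rintro _ ⟨X, hX, rfl, hXk, hXl⟩ _ ⟨Y, hY, rfl, hYk, hYl⟩ hne
    -- The tail of a shared edge lies in both shores, so each contains the other; for `𝒯` the head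
    -- plays this role in the complements.
    refine Set.disjoint_left.2 fun e heX heY => hne ?_
    have h1 := (hXl Y hY).resolve_right (Set.not_disjoint_iff.2 ⟨_, heX.1, heY.1⟩)
    have h2 := (hYl X hX).resolve_right (Set.not_disjoint_iff.2 ⟨_, heY.1, heX.1⟩)
    rw [h1.antisymm h2]
  have h𝒯 : 𝒯.PairwiseDisjoint id := by
    rintro _ ⟨X, hX, rfl, hXk, hXl⟩ _ ⟨Y, hY, rfl, hYk, hYl⟩ hne
    refine Set.disjoint_left.2 fun e heX heY => hne ?_
    have h1 := (hXl Y hY).resolve_right fun h => heY.2 (h heX.2)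
    have h2 := (hYl X hX).resolve_right fun h => heX.2 (h heY.2)
    rw [h2.antisymm h1]
  obtain ⟨col, hlt, hcol⟩ := exists_injOn_of_pairwiseDisjoint 𝒮 𝒯 hk h𝒮 h𝒯 (by
    rintro _ (⟨X, -, -, h, -⟩ | ⟨X, -, -, h, -⟩) <;> exact h.le)
  refine ⟨col, fun X hX hXk => isRainbow_of_injOn hXk (fun e _ => hlt e) (hcol _ ?_)⟩
  rcases hext X hX hXk with h | h
  · exact .inr ⟨X, hX, rfl, hXk, h⟩
  · exact .inl ⟨X, hX, rfl, hXk, h⟩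

/-- Let `L` be a finite lattice of tail-closed sets such that every non-empty cut of a member of `L`
has at least `k` edges. Then the edges can be coloured with every cut of `k` edges rainbow. -/
theorem exists_isRainbow [Finite E] (D : Multidigraph V E) {k : ℕ} (hk : 0 < k)
    (L : Set (Set V)) (hfin : L.Finite) (hclosed : ∀ Z ∈ L, D.IsTailClosed Z)
    (hinter : ∀ X ∈ L, ∀ Y ∈ L, X ∩ Y ∈ L) (hunion : ∀ X ∈ L, ∀ Y ∈ L, X ∪ Y ∈ L)
    (hcompl : ∀ X ∈ L, D.outCut X = ∅ → Xᶜ ∈ L)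
    (hge : ∀ X ∈ L, D.outCut X = ∅ ∨ k ≤ (D.outCut X).ncard) :
    ∃ col : E → ℕ, ∀ Z ∈ L, (D.outCut Z).ncard = k → D.IsRainbow col k Z := by
  classical
  induction hn : L.ncard using Nat.strong_induction_on generalizing L with
  | _ n ih =>
  subst hn
  by_cases hext : ∀ X ∈ L, (D.outCut X).ncard = k →
      (∀ Z ∈ L, Z ⊆ X ∨ Xᶜ ⊆ Z) ∨ (∀ Z ∈ L, X ⊆ Z ∨ Disjoint X Z)
  · exact D.exists_isRainbow_of_extreme hk L hext
  push Not at hext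
  obtain ⟨X, hX, hXk, ⟨Z₁, hZ₁, hZ₁X, hZ₁X'⟩, ⟨Z₂, hZ₂, hZ₂X, hZ₂X'⟩⟩ := hext
  -- `L₁` and `L₂` consist of the members that survive contracting `Xᶜ` or `X`, respectively, to a
  -- vertex; `Z₁` and `Z₂` witness that both are smaller.
  let L₁ : Set (Set V) := {Z ∈ L | Z ⊆ X ∨ Xᶜ ⊆ Z}
  let L₂ : Set (Set V) := {Z ∈ L | X ⊆ Z ∨ Disjoint X Z}
  have hs₁ : L₁ ⊂ L := ⟨fun Z h => h.1, fun h => (h hZ₁).2.elim hZ₁X hZ₁X'⟩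
  have hs₂ : L₂ ⊂ L := ⟨fun Z h => h.1, fun h => (h hZ₂).2.elim hZ₂X hZ₂X'⟩
  obtain ⟨col₁, hcol₁⟩ := ih _ (Set.ncard_lt_ncard hs₁ hfin) L₁ (hfin.subset hs₁.1)
    (fun Z hZ => hclosed Z hZ.1)
    (fun Y hY Z hZ => ⟨hinter Y hY.1 Z hZ.1, by
      rcases hY.2 with h | h
      · exact .inl (Set.inter_subset_left.trans h)
      rcases hZ.2 with h' | h'
      · exact .inl (Set.inter_subset_right.trans h')
      · exact .inr (Set.subset_inter h h')⟩)
    (fun Y hY Z hZ => ⟨hunion Y hY.1 Z hZ.1, by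
      rcases hY.2 with h | h
      · rcases hZ.2 with h' | h'
        · exact .inl (Set.union_subset h h')
        · exact .inr (h'.trans Set.subset_union_right)
      · exact .inr (h.trans Set.subset_union_left)⟩)
    (fun Y hY h => ⟨hcompl Y hY.1 h, by
      rcases hY.2 with h | h
      · exact .inr (Set.compl_subset_compl.2 h)
      · exact .inl (Set.compl_subset_comm.1 h)⟩)
    (fun Y hY => hge Y hY.1) rfl
  obtain ⟨col₂, hcol₂⟩ := ih _ (Set.ncard_lt_ncard hs₂ hfin) L₂ (hfin.subset hs₂.1)
    (fun Z hZ => hclosed Z hZ.1)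
    (fun Y hY Z hZ => ⟨hinter Y hY.1 Z hZ.1, by
      rcases hY.2 with h | h
      · rcases hZ.2 with h' | h'
        · exact .inl (Set.subset_inter h h')
        · exact .inr (h'.mono_right Set.inter_subset_right)
      · exact .inr (h.mono_right Set.inter_subset_left)⟩)
    (fun Y hY Z hZ => ⟨hunion Y hY.1 Z hZ.1, by
      rcases hY.2 with h | h
      · exact .inl (h.trans Set.subset_union_left)
      rcases hZ.2 with h' | h'
      · exact .inl (h'.trans Set.subset_union_right)
      · exact .inr (Set.disjoint_union_right.2 ⟨h, h'⟩)⟩)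
    (fun Y hY h => ⟨hcompl Y hY.1 h, by
      rcases hY.2 with h | h
      · exact .inr (Set.disjoint_compl_right_iff_subset.2 h)
      · exact .inl (Set.subset_compl_iff_disjoint_right.2 h)⟩)
    (fun Y hY => hge Y hY.1) rfl
  have hXc := hclosed X hX
  have hX₁ := hcol₁ X ⟨hX, .inl subset_rfl⟩ hXk
  have hX₂ := (hcol₂ X ⟨hX, .inl subset_rfl⟩ hXk).bijOn hXk
  -- permute the colours of the second colouring so that both agree on the edges leaving `X`
  obtain ⟨τ, hτ⟩ : ∃ τ : ℕ → ℕ, ∀ e ∈ D.outCut X, τ (col₂ e) = col₁ e := by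
    refine ⟨fun i => if h : ∃ e ∈ D.outCut X, col₂ e = i then col₁ h.choose else 0, fun e he => ?_⟩
    have h : ∃ e' ∈ D.outCut X, col₂ e' = col₂ e := ⟨e, he, rfl⟩
    simp only [dif_pos h]
    rw [hX₂.injOn h.choose_spec.1 he h.choose_spec.2]
  have hτbij : Set.BijOn τ (Set.Iio k) (Set.Iio k) := by
    have h1 : Set.EqOn (τ ∘ col₂) col₁ (D.outCut X) := hτ
    have h2 := (h1.bijOn_iff).2 (hX₁.bijOn hXk)
    refine ⟨?_, ?_, ?_⟩
    · intro i hi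
      obtain ⟨e, he, rfl⟩ := hX₂.surjOn hi
      exact h2.mapsTo he
    · intro i hi j hj hij
      obtain ⟨e, he, rfl⟩ := hX₂.surjOn hi
      obtain ⟨e', he', rfl⟩ := hX₂.surjOn hj
      rw [h2.injOn he he' hij]
    · intro i hi
      obtain ⟨e, he, rfl⟩ := h2.surjOn hi
      exact ⟨col₂ e, hX₂.mapsTo he, rfl⟩
  -- Edges leaving a member of `L₁` have their tail in X. An edge leaving a member of `L₂` with its
  -- tail in X lies in the cut of X, where the two colourings agree.
  let col : E → ℕ := fun e => if D.tail e ∈ X then col₁ e else τ (col₂ e)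
  have h₁ : ∀ Z ∈ L₁, (D.outCut Z).ncard = k → D.IsRainbow col k Z := by
    intro Z hZ hZk
    refine (isRainbow_congr rfl fun e he => ?_).1 (hcol₁ Z hZ hZk)
    have : D.tail e ∈ X := by
      rcases hZ.2 with h | h
      · exact h he.1
      · exact hXc e (by_contra fun h' => he.2 (h h'))
    simp [col, this]
  have h₂ : ∀ Z ∈ L₂, (D.outCut Z).ncard = k → D.IsRainbow col k Z := by
    intro Z hZ hZk
    have hb := (hcol₂ Z hZ hZk).bijOn hZk
    have hb' := hτbij.comp hb
    refine (isRainbow_congr rfl fun e he => ?_).1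
      (isRainbow_of_injOn hZk (fun e he => hb'.mapsTo he) hb'.injOn)
    by_cases h : D.tail e ∈ X
    · have : e ∈ D.outCut X := by
        refine ⟨h, ?_⟩
        rcases hZ.2 with h' | h'
        · exact fun h'' => he.2 (h' h'')
        · exact (Set.disjoint_left.1 h' h he.1).elim
      simp [col, h, hτ e this]
    · simp [col, h]
  refine ⟨col, fun Y hY hYk => ?_⟩
  have hYc := hclosed Y hY
  have hmod := ncard_outCut_inter_add_union hXc hYc Set.univ
  simp only [Set.inter_univ] at hmod
  have hi := hinter X hX Y hY
  have hu := hunion X hX Y hY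
  rcases hge _ hi with h0 | hik
  · -- the edges leaving `Y` are those leaving `Y \ X`
    have hd : Y ∩ (X ∩ Y)ᶜ ∈ L := hinter _ hY _ (hcompl _ hi h0)
    have hcut : D.outCut (Y ∩ (X ∩ Y)ᶜ) = D.outCut Y := by
      ext e
      have h1 : e ∉ D.outCut (X ∩ Y) := h0 ▸ Set.notMem_empty e
      have h2 := hXc e
      have h3 := hYc e
      simp only [outCut, Set.mem_ofPred_eq, Set.mem_inter_iff, Set.mem_compl_iff] at *
      tauto
    refine (isRainbow_congr hcut fun _ _ => rfl).1 (h₂ _ ⟨hd, .inr ?_⟩ (hcut ▸ hYk))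
    exact Set.disjoint_left.2 fun v hv hv' => hv'.2 ⟨hv, hv'.1⟩
  rcases hge _ hu with h0 | huk
  · have hd : Y ∪ (X ∪ Y)ᶜ ∈ L := hunion _ hY _ (hcompl _ hu h0)
    have hcut : D.outCut (Y ∪ (X ∪ Y)ᶜ) = D.outCut Y := by
      ext e
      have h1 : e ∉ D.outCut (X ∪ Y) := h0 ▸ Set.notMem_empty e
      have h2 := hXc e
      have h3 := hYc e
      simp only [outCut, Set.mem_ofPred_eq, Set.mem_union, Set.mem_compl_iff] at *
      tauto
    refine (isRainbow_congr hcut fun _ _ => rfl).1 (h₁ _ ⟨hd, .inr ?_⟩ (hcut ▸ hYk))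
    intro v hv
    by_cases hvY : v ∈ Y
    · exact .inl hvY
    · exact .inr fun h => h.elim hv hvY
  · exact IsRainbow.of_inter_union hXc hYc (h₁ X ⟨hX, .inl subset_rfl⟩ hXk)
      (h₁ _ ⟨hi, .inl Set.inter_subset_left⟩ (by omega))
      (h₂ _ ⟨hu, .inl Set.subset_union_left⟩ (by omega))

end Multidigraph

section Compactness

/-- If for every finite subfamily of a family of finite sets there is a colouring with finitely many
colours in which each member of the subfamily has all colours, then there is one such colouring
for the whole family. -/
theorem exists_surjOn_of_finite {E κ : Type*} [Finite κ] (𝔅 : Set (Set E))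
    (hfin : ∀ B ∈ 𝔅, B.Finite)
    (h : ∀ 𝔉 : Finset 𝔅, ∃ col : E → κ, ∀ B ∈ 𝔉, Set.SurjOn col B Set.univ) :
    ∃ col : E → κ, ∀ B ∈ 𝔅, Set.SurjOn col B Set.univ := by
  let _ : TopologicalSpace κ := ⊥
  have _ : DiscreteTopology κ := ⟨rfl⟩
  have hclosed : ∀ B : 𝔅, IsClosed {col : E → κ | Set.SurjOn col B Set.univ} := by
    intro B
    have : {col : E → κ | Set.SurjOn col B Set.univ} =
        ⋂ i : κ, ⋃ e ∈ (B : Set E), (fun col : E → κ => col e) ⁻¹' {i} := by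
      ext col
      simp [Set.SurjOn, Set.subset_def]
    rw [this]
    exact isClosed_iInter fun i => (hfin B B.2).isClosed_biUnion fun e _ =>
      (isClosed_discrete _).preimage (continuous_apply e)
  obtain ⟨col, -, hcol⟩ := isCompact_univ.inter_iInter_nonempty
    (fun B : 𝔅 => {col : E → κ | Set.SurjOn col B Set.univ}) hclosed fun 𝔉 => by
      obtain ⟨col, hcol⟩ := h 𝔉
      exact ⟨col, Set.mem_univ _, Set.mem_iInter₂.2 hcol⟩
  exact ⟨col, fun B hB => Set.mem_iInter.1 hcol ⟨B, hB⟩⟩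

end Compactness

section Copies

variable {E : Type u}

/-- The disjoint union of `c e` copies of every edge `e` of finite capacity. -/
abbrev EdgeCopies (c : E → Cardinal.{u}) : Type u := Σ e, Fin (Cardinal.toNat (c e))

theorem le_capacityOf (c : E → Cardinal.{u}) {B : Set E} {e : E} (he : e ∈ B) :
    c e ≤ capacityOf c B :=
  Cardinal.le_sum (fun e : B => c e) ⟨e, he⟩

theorem mk_preimage_fst_edgeCopies (c : E → Cardinal.{u}) {B : Set E} (hB : ∀ e ∈ B, c e < ℵ₀) :
    #((Sigma.fst : EdgeCopies c → E) ⁻¹' B) = capacityOf c B := by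
  let φ : ((Sigma.fst : EdgeCopies c → E) ⁻¹' B) ≃
      Σ e : B, ULift.{u} (Fin (Cardinal.toNat (c e))) :=
    { toFun := fun x => ⟨⟨x.1.1, x.2⟩, ⟨x.1.2⟩⟩
      invFun := fun x => ⟨⟨x.1.1, x.2.down⟩, x.1.2⟩
      left_inv := fun _ => rfl
      right_inv := fun _ => rfl }
  rw [Cardinal.mk_congr φ, Cardinal.mk_sigma, capacityOf]
  refine congrArg Cardinal.sum ?_
  funext e
  rw [Cardinal.mk_uLift, Cardinal.mk_fin, Cardinal.lift_natCast,
    Cardinal.cast_toNat_of_lt_aleph0 (hB e e.2)]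

end Copies

namespace Multidigraph

variable {V : Type v} {E : Type u}

/-- If the non-empty dicuts have capacity at least `k`, then for finitely many dicuts of capacity
`k`, the copies of the edges can be coloured with `k` colours such that each of these dicuts has
all colours. -/
theorem exists_surjOn_edgeCopies_of_finite (D : Multidigraph V E) (c : E → Cardinal.{u}) {k : ℕ}
    (hk : 0 < k)
    (hge : ∀ Z, D.IsTailClosed Z → D.outCut Z = ∅ ∨ (k : Cardinal) ≤ capacityOf c (D.outCut Z))
    (𝒳 : Set (Set V)) (h𝒳 : 𝒳.Finite)
    (hmin : ∀ X ∈ 𝒳, D.IsTailClosed X ∧ capacityOf c (D.outCut X) = k) :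
    ∃ col : EdgeCopies c → Fin k,
      ∀ X ∈ 𝒳, Set.SurjOn col (Sigma.fst ⁻¹' D.outCut X) Set.univ := by
  classical
  have := h𝒳.to_subtype
  have := h𝒳.fintype
  let U : Set E := ⋃ X ∈ 𝒳, D.outCut X
  have hlt : ∀ e ∈ U, c e < ℵ₀ := by
    intro e he
    obtain ⟨X, hX, heX⟩ := Set.mem_iUnion₂.1 he
    refine (le_capacityOf c heX).trans_lt ?_
    rw [(hmin X hX).2]
    exact Cardinal.natCast_lt_aleph0
  let P : Set (EdgeCopies c) := Sigma.fst ⁻¹' U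
  have hPfin : P.Finite := by
    have : P = ⋃ X ∈ 𝒳, (Sigma.fst : EdgeCopies c → E) ⁻¹' D.outCut X := by
      simp only [P, U, Set.preimage_iUnion]
    rw [this]
    refine h𝒳.biUnion fun X hX => Cardinal.lt_aleph0_iff_set_finite.1 ?_
    rw [mk_preimage_fst_edgeCopies c fun e he => hlt e (Set.mem_biUnion hX he), (hmin X hX).2]
    exact Cardinal.natCast_lt_aleph0
  have := hPfin.to_subtype
  let D' : Multidigraph V P := ⟨fun e => D.tail e.1.1, fun e => D.head e.1.1⟩
  let π : V → 𝒳 → Prop := fun v X => v ∈ X.1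
  let L : Set (Set V) := {Z | D.IsTailClosed Z ∧ ∃ W : Set (𝒳 → Prop), Z = π ⁻¹' W}
  have hLfin : L.Finite :=
    (Set.finite_range fun W : Set (𝒳 → Prop) => π ⁻¹' W).subset fun Z hZ => by
      obtain ⟨W, rfl⟩ := hZ.2
      exact ⟨W, rfl⟩
  have hLU : ∀ Z ∈ L, D.outCut Z ⊆ U := by
    rintro _ ⟨hZ, W, rfl⟩ e ⟨ht, hh⟩
    have : π (D.tail e) ≠ π (D.head e) := fun h => hh (show π (D.head e) ∈ W from h ▸ ht)
    obtain ⟨X, hX⟩ := Function.ne_iff.1 this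
    have h1 := (hmin X X.2).1 e
    refine Set.mem_biUnion X.2 ?_
    simp only [π, ne_eq, eq_iff_iff] at hX
    simp only [outCut, Set.mem_ofPred_eq]
    tauto
  have hcard : ∀ Z ∈ L, ((D'.outCut Z).ncard : Cardinal) = capacityOf c (D.outCut Z) := by
    intro Z hZ
    rw [← mk_preimage_fst_edgeCopies c fun e he => hlt e (hLU Z hZ he),
      Set.cast_ncard (Set.toFinite _)]
    exact Cardinal.mk_preimage_of_injective_of_subset_range (Subtype.val : P → EdgeCopies c)
      (Sigma.fst ⁻¹' D.outCut Z) Subtype.val_injective fun e he => ⟨⟨e, hLU Z hZ he⟩, rfl⟩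
  have hge' : ∀ Z ∈ L, D.outCut Z = ∅ ∨ k ≤ (D'.outCut Z).ncard := fun Z hZ =>
    (hge Z hZ.1).imp_right fun h => by
      rw [← hcard Z hZ] at h
      exact_mod_cast h
  obtain ⟨col, hcol⟩ := D'.exists_isRainbow hk L hLfin (fun Z hZ e => hZ.1 e.1.1)
    (by
      rintro _ ⟨hX, W, rfl⟩ _ ⟨hY, W', rfl⟩
      exact ⟨hX.inter hY, W ∩ W', rfl⟩)
    (by
      rintro _ ⟨hX, W, rfl⟩ _ ⟨hY, W', rfl⟩
      exact ⟨hX.union hY, W ∪ W', rfl⟩)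
    (by
      intro X hX h
      have h0 : D.outCut X = ∅ := (hge' X hX).resolve_right fun h' => by
        rw [h, Set.ncard_empty] at h'
        omega
      obtain ⟨-, W, rfl⟩ := hX
      exact ⟨IsTailClosed.compl h0, Wᶜ, rfl⟩)
    (by
      intro X hX
      refine (hge' X hX).imp_left fun h => Set.eq_empty_of_forall_notMem fun e he => ?_
      have he' : e.1.1 ∈ D.outCut X := he
      exact Set.notMem_empty _ (h ▸ he'))
  refine ⟨fun e => ⟨(if h : e ∈ P then col ⟨e, h⟩ else 0) % k, Nat.mod_lt _ hk⟩, ?_⟩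
  intro X hX i _
  have hXL : X ∈ L := ⟨(hmin X hX).1, {w | w ⟨X, hX⟩}, rfl⟩
  have hXk : (D'.outCut X).ncard = k := by
    have := hcard X hXL
    rw [(hmin X hX).2] at this
    exact_mod_cast this
  obtain ⟨e, he⟩ := Set.ncard_eq_one.1 (hcol X hXL hXk i i.2)
  have he' : e ∈ D'.outCut X ∩ col ⁻¹' {i.1} := he ▸ rfl
  refine ⟨e.1, he'.1, Fin.ext ?_⟩
  have h2 : col e = i := he'.2
  simp [h2, Nat.mod_eq_of_lt i.2]

/-- If the non-empty dicuts have capacity at least `k`, then the copies of the edges can be coloured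
with `k` colours such that each dicut of capacity `k` has all colours. -/
theorem exists_surjOn_edgeCopies (D : Multidigraph V E) (c : E → Cardinal.{u}) {k : ℕ}
    (hk : 0 < k)
    (hge : ∀ Z, D.IsTailClosed Z → D.outCut Z = ∅ ∨ (k : Cardinal) ≤ capacityOf c (D.outCut Z)) :
    ∃ col : EdgeCopies c → Fin k, ∀ X, D.IsTailClosed X → capacityOf c (D.outCut X) = k →
      Set.SurjOn col (Sigma.fst ⁻¹' D.outCut X) Set.univ := by
  classical
  obtain ⟨col, hcol⟩ := exists_surjOn_of_finite (κ := Fin k)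
    {B : Set (EdgeCopies c) | ∃ X, B = Sigma.fst ⁻¹' D.outCut X ∧ D.IsTailClosed X ∧
      capacityOf c (D.outCut X) = k}
    (by
      rintro _ ⟨X, rfl, -, hX⟩
      refine Cardinal.lt_aleph0_iff_set_finite.1 ?_
      rw [mk_preimage_fst_edgeCopies c, hX]
      · exact Cardinal.natCast_lt_aleph0
      · intro e he
        exact (le_capacityOf c he).trans_lt (hX ▸ Cardinal.natCast_lt_aleph0))
    (by
      intro 𝔉
      choose X hX using fun B : {B : Set (EdgeCopies c) | ∃ X, B = Sigma.fst ⁻¹' D.outCut X ∧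
        D.IsTailClosed X ∧ capacityOf c (D.outCut X) = k} => B.2
      obtain ⟨col, hcol⟩ := D.exists_surjOn_edgeCopies_of_finite c hk hge (X '' 𝔉)
        (𝔉.finite_toSet.image X) (by
          rintro _ ⟨B, -, rfl⟩
          exact (hX B).2)
      exact ⟨col, fun B hB => (hX B).1 ▸ hcol (X B) ⟨B, hB, rfl⟩⟩)
  exact ⟨col, fun X hX hXk => hcol _ ⟨X, rfl, hX, hXk⟩⟩

end Multidigraph

section Packing

variable {E : Type u}

/-- A `c`-disjoint family of dijoins has at most as many members as a dicut has capacity. -/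
theorem mk_le_capacityOf {c : E → Cardinal.{u}} {𝔅 : Set (Set E)} {B : Set E} (hB : B ∈ 𝔅)
    {ι : Type u} {F : ι → Set E} (hF : ∀ i, IsDijoin 𝔅 (F i)) (hc : ∀ e, #{i | e ∈ F i} ≤ c e) :
    #ι ≤ capacityOf c B := by
  choose f hf using fun i => hF i B hB
  let φ : ι → Σ e : B, {i | e.1 ∈ F i} := fun i => ⟨⟨f i, (hf i).2⟩, ⟨i, (hf i).1⟩⟩
  have hφ : Function.Injective φ := fun i j h =>
    congrArg (fun x : Σ e : B, {i | e.1 ∈ F i} => x.2.1) h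
  refine (Cardinal.mk_le_of_injective hφ).trans ?_
  rw [Cardinal.mk_sigma]
  exact Cardinal.sum_le_sum _ _ fun e => hc e

theorem exists_mem_minCapacity (c : E → Cardinal.{u}) {𝔄 : Set (Set E)} (h : 𝔄.Nonempty) :
    (minCapacity c 𝔄).Nonempty := by
  obtain ⟨B, hB, hmin⟩ := (Cardinal.lt_wf.onFun (f := capacityOf c)).has_min 𝔄 h
  exact ⟨B, hB, fun B' hB' => not_lt.1 (hmin B' hB')⟩

theorem capacityOf_one (B : Set E) : capacityOf (fun _ => 1) B = #B := by
  simp [capacityOf]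

theorem minCapacity_one (𝔄 : Set (Set E)) : minCapacity (fun _ => 1) 𝔄 = minSize 𝔄 := by
  simp only [minCapacity, minSize, capacityOf_one]

end Packing

namespace Multidigraph

variable {V : Type v} {E : Type u}

theorem isWoodallWrt_minCapacity (D : Multidigraph V E) {𝔄 : Set (Set E)}
    (h𝔄 : 𝔄 = D.dicuts ∨ 𝔄 = D.nonemptyDicuts) (c : E → Cardinal.{u})
    (hfin : ∃ B ∈ 𝔄, capacityOf c B < ℵ₀) : IsWoodallWrt c (minCapacity c 𝔄) := by
  obtain ⟨B₀, hB₀, hB₀fin⟩ := hfin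
  obtain ⟨B, hB⟩ := exists_mem_minCapacity c ⟨B₀, hB₀⟩
  obtain ⟨k, hk⟩ := Cardinal.lt_aleph0.1 ((hB.2 B₀ hB₀).trans_lt hB₀fin)
  refine ⟨k, ⟨⟨B, hB, hk⟩, ?_⟩, ⟨?_, ?_⟩⟩
  · rintro _ ⟨B', hB', rfl⟩
    exact hk ▸ hB.2 B' hB'.1
  · rcases Nat.eq_zero_or_pos k with rfl | hk0
    · exact ⟨PEmpty, PEmpty.elim, fun i => i.elim, fun e => by simp, by simp⟩
    have hge : ∀ Z, D.IsTailClosed Z →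
        D.outCut Z = ∅ ∨ (k : Cardinal) ≤ capacityOf c (D.outCut Z) := by
      intro Z hZ
      rw [or_iff_not_imp_left]
      intro hne
      obtain ⟨e, he⟩ := Set.nonempty_iff_ne_empty.2 hne
      have hdi : D.IsDicut (D.outCut Z) := isDicut_iff.2 ⟨Z, ⟨_, he.1⟩, ⟨_, he.2⟩, hZ, rfl⟩
      have hmem : D.outCut Z ∈ 𝔄 := by
        rcases h𝔄 with rfl | rfl
        · exact hdi
        · exact ⟨hdi, e, he⟩
      exact hk ▸ hB.2 _ hmem
    obtain ⟨col, hcol⟩ := D.exists_surjOn_edgeCopies c hk0 hge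
    refine ⟨ULift (Fin k), fun i => {e | ∃ j, col ⟨e, j⟩ = i.down}, ?_, ?_, by simp⟩
    · intro i B' hB'
      have hdi : D.IsDicut B' := by
        rcases h𝔄 with rfl | rfl
        · exact hB'.1
        · exact hB'.1.1
      obtain ⟨X, -, -, hX, rfl⟩ := isDicut_iff.1 hdi
      have hXk : capacityOf c (D.outCut X) = k := hk ▸ (hB'.2 B hB.1).antisymm (hB.2 _ hB'.1)
      obtain ⟨⟨e, j⟩, he, hej⟩ := hcol X hX hXk (Set.mem_univ i.down)
      exact ⟨e, ⟨j, hej⟩, he⟩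
    · intro e
      choose j hj using fun i : {i : ULift.{u} (Fin k) | ∃ j, col ⟨e, j⟩ = i.down} => i.2
      have hinj : Function.Injective fun i => ULift.up.{u} (j i) := fun i i' h => by
        have h' : j i = j i' := congrArg ULift.down h
        exact Subtype.ext (ULift.ext _ _ (by rw [← hj i, ← hj i', h']))
      refine (Cardinal.mk_le_of_injective hinj).trans ?_
      simp
  · rintro _ ⟨ι, F, hF, hc, rfl⟩
    exact hk ▸ mk_le_capacityOf hB hF hc

/-- The unweighted packing statement follows from the weighted one with all capacities one. -/
theorem isWoodall_of_isWoodallWrt_one {𝔅 : Set (Set E)} (h : IsWoodallWrt (fun _ => 1) 𝔅) :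
    IsWoodall 𝔅 := by
  obtain ⟨m, hleast, ⟨ι, F, hF, hc, rfl⟩, hub⟩ := h
  simp only [capacityOf_one] at hleast
  refine ⟨#ι, hleast, ⟨Set.range F, ?_, ?_, ?_⟩, ?_⟩
  · rintro _ ⟨i, rfl⟩
    exact hF i
  · rintro _ ⟨i, rfl⟩ _ ⟨j, rfl⟩ hne
    refine Set.disjoint_left.2 fun e hi hj => hne ?_
    have := Cardinal.mk_le_one_iff_set_subsingleton.1 (hc e) hi hj
    rw [this]
  · obtain ⟨B, hB, -⟩ := hleast.1
    refine Cardinal.mk_range_eq F fun i j hij => ?_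
    obtain ⟨e, he, -⟩ := hF i B hB
    exact Cardinal.mk_le_one_iff_set_subsingleton.1 (hc e) he
      (show e ∈ F j from hij ▸ he)
  · rintro _ ⟨𝓕, h𝓕, hd, rfl⟩
    refine hub ⟨𝓕, Subtype.val, fun F => h𝓕 F F.2, fun e => ?_, rfl⟩
    refine Cardinal.mk_le_one_iff_set_subsingleton.2 fun F₁ h₁ F₂ h₂ => ?_
    by_contra hne
    exact Set.disjoint_left.1 (hd F₁ F₁.2 F₂ F₂.2 fun h => hne (Subtype.ext h)) h₁ h₂

end Multidigraph

theorem theorem2 {V : Type v} {E : Type u} (D : Multidigraph V E)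
    (𝔄 : Set (Set E)) (h𝔄 : 𝔄 = D.dicuts ∨ 𝔄 = D.nonemptyDicuts) :
    -- minimum size, in a digraph with a finite dicut
    ((∃ B ∈ 𝔄, B.Finite) → IsWoodall (minSize 𝔄)) ∧
    -- minimum capacity, for an arbitrary capacity with a dicut of finite capacity
    (∀ c : E → Cardinal.{u}, (∃ B ∈ 𝔄, capacityOf c B < ℵ₀) →
      IsWoodallWrt c (minCapacity c 𝔄)) ∧
    -- minimum capacity, in a finite digraph with a finitary capacity
    (Finite V → Finite E → 𝔄.Nonempty → ∀ c : E → ℕ,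
      IsWoodallWrt (fun e => (c e : Cardinal.{u})) (minCapacity (fun e => (c e : Cardinal.{u})) 𝔄)) := by
  refine ⟨fun ⟨B, hB, hfin⟩ => ?_, fun c hc => D.isWoodallWrt_minCapacity h𝔄 c hc, ?_⟩
  · rw [← minCapacity_one]
    refine Multidigraph.isWoodall_of_isWoodallWrt_one
      (D.isWoodallWrt_minCapacity h𝔄 _ ⟨B, hB, ?_⟩)
    rw [capacityOf_one]
    exact Cardinal.lt_aleph0_iff_set_finite.2 hfin
  · rintro - _ ⟨B, hB⟩ c
    refine D.isWoodallWrt_minCapacity h𝔄 _ ⟨B, hB, ?_⟩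
    rw [← mk_preimage_fst_edgeCopies _ fun e _ => Cardinal.natCast_lt_aleph0]
    exact Cardinal.mk_lt_aleph0
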